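/- Let $\mathcal X\subseteq\mathbb R^{m_1}$ and $\mathcal A\subseteq\mathbb R^{m_2}$ be compact, let $\mathcal Y=\{1,-1\}$, and let $\|\cdot\|_p$, $\|\cdot\|_{p'}$ be the $p$- and $p'$-norms with $p,p'\in[1,\infty]$. Let $\kappa_A,\kappa_P,r_A,r_P\in\mathbb R$, let $(x^A_i,a^A_i)\in\mathcal X\times\mathcal A$ for $1\le i\le n_A$ and $(x^P_j,y^P_j)\in\mathcal X\times\mathcal Y$ for $1\le j\le n_P$ be two datasets with $n_A,n_P\ge 1$, and put $$d_A^i(x,a)=\|x^A_i-x\|_p+\kappa_A\|a^A_i-a\|_{p'},\qquad d_P^j(x,y)=\|x^P_j-x\|_p+\kappa_P|y^P_j-y|.$$ For $\theta\in\mathbb R^{m_1+m_2}$ let $\ell(\theta,(x,a,y))=\log\bigl(1+\exp(-y\langle\theta,(x,a)\rangle)\bigr)$ be the logistic loss. Let $p^*(\theta,r_A,r_P)$ be the optimal value of the primal problem, in which the variables are (nonnegative) Borel measures $\pi^y_{i,j}$ on $\mathcal X\times\mathcal A$, for $i\in[n_A]$, $j\in[n_P]$, $y\in\mathcal Y$: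 $$\begin{aligned}\sup_{\pi}\quad&\sum_{i,j,y}\int \ell(\theta,(x,a,y))\,\pi^y_{i,j}(dx,da)\\ \text{s.t.}\quad&\sum_{i,j,y}\int d_A^i(x,a)\,\pi^y_{i,j}(dx,da)\le r_A,\qquad \sum_{i,j,y}\int d_P^j(x,y)\,\pi^y_{i,j}(dx,da)\le r_P,\\ &\sum_{j,y}\pi^y_{i,j}(\mathcal X\times\mathcal A)=\tfrac1{n_A}\ \ \forall i,\qquad \sum_{i,y}\pi^y_{i,j}(\mathcal X\times\mathcal A)=\tfrac1{n_P}\ \ \forall j,\end{aligned}$$ and let $d^*(\theta,r_A,r_P)$ be the optimal value of the semi-infinite dual problem $$\begin{aligned}\inf_{\alpha_A,\alpha_P\ge 0,\ \beta\in\mathbb R^{n_A},\ \beta'\in\mathbb R^{n_P}}\quad&\alpha_A r_A+\alpha_P r_P+\frac1{n_A}\sum_{i}\beta_i+\frac1{n_P}\sum_{j}\beta'_j\\ \text{s.t.}\quad&\sup_{(x,a)\in\mathcal X\times\mathcal A}\bigl(\ell(\theta,(x,a,y))-\alpha_A d_A^i(x,a)-\alpha_P d_P^j(x,y)\bigr)\le\beta_i+\beta'_j\quad\forall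 i,j,y.\end{aligned}$$ If the primal problem has a feasible solution, then strong duality holds for every fixed $\theta$: $p^*(\theta,r_A,r_P)=d^*(\theta,r_A,r_P)$. -/

import Mathlib

open scoped ENNReal BigOperators

noncomputable section

namespace DataJoin

/-- The data of a distributionally robust data join problem: the feature domain `X ⊆ ℝ^{m₁}`, the
auxiliary domain `A ⊆ ℝ^{m₂}`, the exponents `p`, `p'` of the two norms, the weights `κA`, `κP`, the
auxiliary feature dataset `(xA i, aA i)`, the prediction label dataset `(xP j, yP j)`, and the radii
`rA`, `rP`. The label space `{1, -1}` is the type `ℤˣ`. -/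
structure Problem (m₁ m₂ : ℕ) where
  X : Set (Fin m₁ → ℝ)
  A : Set (Fin m₂ → ℝ)
  p : ℝ≥0∞
  p' : ℝ≥0∞
  κA : ℝ
  κP : ℝ
  nA : ℕ
  nP : ℕ
  xA : Fin nA → X
  aA : Fin nA → A
  xP : Fin nP → X
  yP : Fin nP → ℤˣ
  rA : ℝ
  rP : ℝ

/-- The `p`-norm of a vector of `ℝ^m`. -/
def normLp {m : ℕ} (p : ℝ≥0∞) (v : Fin m → ℝ) : ℝ :=
  ‖(WithLp.toLp p v : PiLp p (fun _ : Fin m => ℝ))‖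

/-- The real number `1` or `-1` given by a label. -/
def label (y : ℤˣ) : ℝ := ((y : ℤ) : ℝ)

/-- The logistic loss `log (1 + exp (-y ⟨θ, (x, a)⟩))`. -/
def loss {m₁ m₂ : ℕ} (θ : Fin (m₁ + m₂) → ℝ) (x : Fin m₁ → ℝ) (a : Fin m₂ → ℝ) (y : ℤˣ) : ℝ :=
  Real.log (1 + Real.exp (-label y * (θ ⬝ᵥ Fin.append x a)))

namespace Problem

variable {m₁ m₂ : ℕ} (D : Problem m₁ m₂)

/-- `d_A((x, a), (x', a')) = ‖x - x'‖_p + κ_A ‖a - a'‖_{p'}`. -/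
def distA (x : Fin m₁ → ℝ) (a : Fin m₂ → ℝ) (x' : Fin m₁ → ℝ) (a' : Fin m₂ → ℝ) : ℝ :=
  normLp D.p (x - x') + D.κA * normLp D.p' (a - a')

/-- `d_P((x, y), (x', y')) = ‖x - x'‖_p + κ_P |y - y'|`. -/
def distP (x : Fin m₁ → ℝ) (y : ℤˣ) (x' : Fin m₁ → ℝ) (y' : ℤˣ) : ℝ :=
  normLp D.p (x - x') + D.κP * |label y - label y'|

/-- The distance `d_A` from the `i`-th point of the auxiliary feature dataset. -/
def dA (i : Fin D.nA) (x : Fin m₁ → ℝ) (a : Fin m₂ → ℝ) : ℝ :=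
  D.distA (D.xA i) (D.aA i) x a

/-- The distance `d_P` from the `j`-th point of the prediction label dataset. -/
def dP (j : Fin D.nP) (x : Fin m₁ → ℝ) (y : ℤˣ) : ℝ :=
  D.distP (D.xP j) (D.yP j) x y

/-- The variable of the primal problem: a family `π i j y` of nonnegative Borel measures on
`X × A`. -/
abbrev Plan : Type := Fin D.nA → Fin D.nP → ℤˣ → MeasureTheory.Measure (D.X × D.A)

/-- The constraints of the primal problem. The marginal constraints are equalities of extended
nonnegative reals, so they make every `π i j y` a finite measure. -/
structure PrimalFeasible (π : D.Plan) : Prop where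
  costA : ∑ i, ∑ j, ∑ y, ∫ z, D.dA i z.1 z.2 ∂(π i j y) ≤ D.rA
  costP : ∑ i, ∑ j, ∑ y, ∫ z, D.dP j z.1 y ∂(π i j y) ≤ D.rP
  marginalA : ∀ i, ∑ j, ∑ y, π i j y Set.univ = 1 / (D.nA : ℝ≥0∞)
  marginalP : ∀ j, ∑ i, ∑ y, π i j y Set.univ = 1 / (D.nP : ℝ≥0∞)

/-- The objective of the primal problem. -/
def primalObjective (θ : Fin (m₁ + m₂) → ℝ) (π : D.Plan) : ℝ :=
  ∑ i, ∑ j, ∑ y, ∫ z, loss θ z.1 z.2 y ∂(π i j y)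

/-- The optimal value `p*(θ, r_A, r_P)` of the primal problem, as an extended real. -/
def primalValue (θ : Fin (m₁ + m₂) → ℝ) : EReal :=
  ⨆ (π : D.Plan) (_ : D.PrimalFeasible π), (D.primalObjective θ π : EReal)

/-- The constraints of the dual problem. The supremum is taken in the extended reals. -/
structure DualFeasible (θ : Fin (m₁ + m₂) → ℝ) (αA αP : ℝ) (β : Fin D.nA → ℝ)
    (β' : Fin D.nP → ℝ) : Prop where
  nonnegA : 0 ≤ αA
  nonnegP : 0 ≤ αP
  sup_le : ∀ i j y,
    (⨆ z : D.X × D.A,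
      ((loss θ z.1 z.2 y - αA * D.dA i z.1 z.2 - αP * D.dP j z.1 y : ℝ) : EReal)) ≤
      ((β i + β' j : ℝ) : EReal)

/-- The objective of the dual problem. -/
def dualObjective (αA αP : ℝ) (β : Fin D.nA → ℝ) (β' : Fin D.nP → ℝ) : ℝ :=
  αA * D.rA + αP * D.rP + 1 / (D.nA : ℝ) * ∑ i, β i + 1 / (D.nP : ℝ) * ∑ j, β' j

/-- The optimal value `d*(θ, r_A, r_P)` of the dual problem, as an extended real. -/
def dualValue (θ : Fin (m₁ + m₂) → ℝ) : EReal :=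
  ⨅ (αA : ℝ) (αP : ℝ) (β : Fin D.nA → ℝ) (β' : Fin D.nP → ℝ)
    (_ : D.DualFeasible θ αA αP β β'), (D.dualObjective αA αP β β' : EReal)

end Problem

end DataJoin

end

open MeasureTheory

/-! Weak duality is integration of the dual constraints against a feasible plan (`integrated_le`
with `c = 1`). For the converse, the infinite-dimensional primal is seen only through finitely many
moments. If `c` exceeds the primal value, no finite plan has moments in the closed convex set
`target c`. The moments of point masses form a compact set, so their convex hull is compact and
consists of moments of finite plans; Hahn-Banach separates it strictly from `target c`. The
unbounded directions of the target fix the signs of the multipliers, and dividing by the coefficient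
of the loss yields a dual point of objective below `c` (`exists_dualFeasible_lt`).

No Slater condition is needed: were that coefficient zero, integrating the separating inequality
against any feasible plan would contradict the strict gap. -/

theorem IsCompact.convexHull_of_finiteDimensional {E : Type*} [AddCommGroup E] [Module ℝ E]
    [TopologicalSpace E] [ContinuousAdd E] [ContinuousSMul ℝ E] [FiniteDimensional ℝ E] {s : Set E}
    (hs : IsCompact s) : IsCompact (convexHull ℝ s) := by
  -- Carathéodory: at most `finrank + 1` points suffice, so the hull is a finite union of continuous
  -- images of compact sets.
  have heq : convexHull ℝ s = ⋃ n ∈ Set.Iic (Module.finrank ℝ E + 1),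
      (fun q : (Fin n → ℝ) × (Fin n → E) => ∑ k, q.1 k • q.2 k) ''
        (stdSimplex ℝ (Fin n) ×ˢ Set.univ.pi fun _ => s) := by
    refine Set.Subset.antisymm (fun x hx => ?_) (Set.iUnion₂_subset fun n _ => ?_)
    · obtain ⟨ι, _, z, w, hz, hind, hw, hw1, rfl⟩ := eq_pos_convex_span_of_mem_convexHull hx
      refine Set.mem_biUnion (x := Fintype.card ι) ?_ ?_
      · exact hind.card_le_finrank_succ.trans
          (Nat.add_le_add_right (Submodule.finrank_le _) 1)
      · let e := Fintype.equivFin ι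
        refine ⟨(w ∘ e.symm, z ∘ e.symm), ⟨⟨fun k => (hw _).le, ?_⟩, fun k _ => hz ⟨_, rfl⟩⟩, ?_⟩
        · exact (Equiv.sum_comp e.symm w).trans hw1
        · exact Equiv.sum_comp e.symm fun i => w i • z i
    · rintro _ ⟨⟨w, z⟩, ⟨hw, hz⟩, rfl⟩
      exact (convex_convexHull ℝ s).sum_mem (fun k _ => hw.1 k) hw.2
        fun k _ => subset_convexHull ℝ s (hz k trivial)
  rw [heq]
  refine (Set.finite_Iic _).isCompact_biUnion fun n _ => ?_
  exact ((isCompact_stdSimplex ℝ (Fin n)).prod (isCompact_univ_pi fun _ => hs)).image (by fun_prop)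

namespace DataJoin

/-! ### Continuity and integrability of the costs and the loss -/

theorem continuous_normLp {m : ℕ} {p : ℝ≥0∞} (hp : 1 ≤ p) :
    Continuous (normLp p : (Fin m → ℝ) → ℝ) := by
  have : Fact (1 ≤ p) := ⟨hp⟩
  exact continuous_norm.comp (PiLp.continuous_toLp p (fun _ : Fin m => ℝ))

theorem continuous_loss {m₁ m₂ : ℕ} (θ : Fin (m₁ + m₂) → ℝ) (y : ℤˣ) :
    Continuous fun z : (Fin m₁ → ℝ) × (Fin m₂ → ℝ) => loss θ z.1 z.2 y := by
  have happ : Continuous fun z : (Fin m₁ → ℝ) × (Fin m₂ → ℝ) => Fin.append z.1 z.2 := by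
    refine continuous_pi fun k => ?_
    refine Fin.addCases (fun i => ?_) (fun i => ?_) k
    · simp only [Fin.append_left]; fun_prop
    · simp only [Fin.append_right]; fun_prop
  unfold loss
  refine Continuous.log ?_ fun z => (by positivity)
  exact continuous_const.add (Real.continuous_exp.comp
    (continuous_const.mul (continuous_const.dotProduct happ)))

namespace Problem

variable {m₁ m₂ : ℕ} (D : Problem m₁ m₂)

theorem continuous_dA (hp : 1 ≤ D.p) (hp' : 1 ≤ D.p') (i : Fin D.nA) :
    Continuous fun z : D.X × D.A => D.dA i z.1 z.2 := by
  have h := continuous_normLp (m := m₁) hp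
  have h' := continuous_normLp (m := m₂) hp'
  unfold dA distA
  exact (h.comp (by fun_prop)).add (continuous_const.mul (h'.comp (by fun_prop)))

theorem continuous_dP (hp : 1 ≤ D.p) (j : Fin D.nP) (y : ℤˣ) :
    Continuous fun z : D.X × D.A => D.dP j z.1 y := by
  have h := continuous_normLp (m := m₁) hp
  unfold dP distP
  exact (h.comp (by fun_prop)).add continuous_const

theorem continuous_loss_coe (θ : Fin (m₁ + m₂) → ℝ) (y : ℤˣ) :
    Continuous fun z : D.X × D.A => loss θ z.1 z.2 y := by
  let v : D.X × D.A → (Fin m₁ → ℝ) × (Fin m₂ → ℝ) := fun z => (z.1, z.2)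
  have hv : Continuous v := by fun_prop
  exact Continuous.comp (g := fun z => loss θ z.1 z.2 y) (f := v) (continuous_loss θ y) hv

variable {D}

theorem integrable_of_continuous (hX : IsCompact D.X) (hA : IsCompact D.A)
    (μ : Measure (D.X × D.A)) [IsFiniteMeasure μ] {g : D.X × D.A → ℝ} (hg : Continuous g) :
    Integrable g μ := by
  have := isCompact_iff_compactSpace.mp hX
  have := isCompact_iff_compactSpace.mp hA
  exact hg.integrable_of_hasCompactSupport (HasCompactSupport.of_compactSpace g)

theorem PrimalFeasible.isFiniteMeasure {π : D.Plan} (h : D.PrimalFeasible π) (i j y) :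
    IsFiniteMeasure (π i j y) := by
  have hn : (1 / (D.nA : ℝ≥0∞)) ≠ ⊤ := by
    have : (D.nA : ℝ≥0∞) ≠ 0 := by
      have := i.pos
      simp only [ne_eq, Nat.cast_eq_zero]; omega
    simp [this]
  rw [← h.marginalA i] at hn
  refine ⟨lt_top_iff_ne_top.mpr fun ht => hn ?_⟩
  exact ENNReal.sum_eq_top.mpr ⟨j, Finset.mem_univ _,
    ENNReal.sum_eq_top.mpr ⟨y, Finset.mem_univ _, ht⟩⟩

theorem PrimalFeasible.real_marginalA {π : D.Plan} (h : D.PrimalFeasible π) (i) :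
    ∑ j, ∑ y, (π i j y).real Set.univ = 1 / (D.nA : ℝ) := by
  have := h.isFiniteMeasure
  have e := congrArg ENNReal.toReal (h.marginalA i)
  rw [ENNReal.toReal_sum fun j _ => ENNReal.sum_ne_top.mpr fun y _ => measure_ne_top _ _] at e
  simp_rw [ENNReal.toReal_sum fun y _ => measure_ne_top (π i _ y) Set.univ] at e
  simpa [Measure.real] using e

theorem PrimalFeasible.real_marginalP {π : D.Plan} (h : D.PrimalFeasible π) (j) :
    ∑ i, ∑ y, (π i j y).real Set.univ = 1 / (D.nP : ℝ) := by
  have := h.isFiniteMeasure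
  have e := congrArg ENNReal.toReal (h.marginalP j)
  rw [ENNReal.toReal_sum fun i _ => ENNReal.sum_ne_top.mpr fun y _ => measure_ne_top _ _] at e
  simp_rw [ENNReal.toReal_sum fun y _ => measure_ne_top (π _ j y) Set.univ] at e
  simpa [Measure.real] using e

/-- Integrating a pointwise inequality between the loss, the two distances and a split function of
the data indices against a feasible plan. -/
theorem PrimalFeasible.integrated_le (hp : 1 ≤ D.p) (hp' : 1 ≤ D.p') (hX : IsCompact D.X)
    (hA : IsCompact D.A) {θ : Fin (m₁ + m₂) → ℝ} {π : D.Plan} (h : D.PrimalFeasible π)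
    {c αA αP : ℝ} {β : Fin D.nA → ℝ} {β' : Fin D.nP → ℝ} (hαA : 0 ≤ αA) (hαP : 0 ≤ αP)
    (hle : ∀ i j y, ∀ z : D.X × D.A,
      c * loss θ z.1 z.2 y - αA * D.dA i z.1 z.2 - αP * D.dP j z.1 y ≤ β i + β' j) :
    c * D.primalObjective θ π ≤ D.dualObjective αA αP β β' := by
  have hfin := h.isFiniteMeasure
  have hint {i j y} {g : D.X × D.A → ℝ} (hg : Continuous g) : Integrable g (π i j y) :=
    integrable_of_continuous hX hA _ hg
  have key : ∀ i j y, c * ∫ z, loss θ z.1 z.2 y ∂(π i j y) - αA * ∫ z, D.dA i z.1 z.2 ∂(π i j y)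
      - αP * ∫ z, D.dP j z.1 y ∂(π i j y)
      ≤ β i * (π i j y).real Set.univ + β' j * (π i j y).real Set.univ := by
    intro i j y
    have hl := (hint (i := i) (j := j) (y := y) (D.continuous_loss_coe θ y)).const_mul c
    have ha := (hint (i := i) (j := j) (y := y) (D.continuous_dA hp hp' i)).const_mul αA
    have hq := (hint (i := i) (j := j) (y := y) (D.continuous_dP hp j y)).const_mul αP
    have := integral_mono ((hl.sub ha).sub hq) (integrable_const (β i + β' j))
      (fun z => hle i j y z)
    rw [integral_sub' (hl.sub ha) hq, integral_sub' hl ha, integral_const, integral_const_mul,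
      integral_const_mul, integral_const_mul, smul_eq_mul] at this
    linarith
  have hsum := Finset.sum_le_sum fun i (_ : i ∈ Finset.univ) =>
    Finset.sum_le_sum fun j (_ : j ∈ Finset.univ) =>
    Finset.sum_le_sum fun y (_ : y ∈ Finset.univ) => key i j y
  simp only [Finset.sum_sub_distrib, Finset.sum_add_distrib, ← Finset.mul_sum] at hsum
  have hA1 : ∑ i, β i * ∑ j, ∑ y, (π i j y).real Set.univ = 1 / (D.nA : ℝ) * ∑ i, β i := by
    simp_rw [h.real_marginalA, Finset.mul_sum, mul_comm]
  have hP1 : ∑ i, ∑ j, β' j * ∑ y, (π i j y).real Set.univ = 1 / (D.nP : ℝ) * ∑ j, β' j := by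
    rw [Finset.sum_comm]
    simp_rw [← Finset.mul_sum, h.real_marginalP, Finset.mul_sum, mul_comm]
  rw [hA1, hP1] at hsum
  have h1 := mul_le_mul_of_nonneg_left h.costA hαA
  have h2 := mul_le_mul_of_nonneg_left h.costP hαP
  unfold primalObjective dualObjective
  linarith

theorem dualFeasible_iff {θ : Fin (m₁ + m₂) → ℝ} {αA αP : ℝ} {β : Fin D.nA → ℝ}
    {β' : Fin D.nP → ℝ} :
    D.DualFeasible θ αA αP β β' ↔ 0 ≤ αA ∧ 0 ≤ αP ∧ ∀ i j y, ∀ z : D.X × D.A,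
      loss θ z.1 z.2 y - αA * D.dA i z.1 z.2 - αP * D.dP j z.1 y ≤ β i + β' j := by
  constructor
  · rintro ⟨h1, h2, h3⟩
    exact ⟨h1, h2, fun i j y z => EReal.coe_le_coe_iff.mp (iSup_le_iff.mp (h3 i j y) z)⟩
  · rintro ⟨h1, h2, h3⟩
    exact ⟨h1, h2, fun i j y => iSup_le fun z => EReal.coe_le_coe_iff.mpr (h3 i j y z)⟩

/-! ### Weak duality -/

theorem primalValue_le_dualValue (hp : 1 ≤ D.p) (hp' : 1 ≤ D.p') (hX : IsCompact D.X)
    (hA : IsCompact D.A) (θ : Fin (m₁ + m₂) → ℝ) : D.primalValue θ ≤ D.dualValue θ := by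
  refine iSup₂_le fun π hπ => ?_
  refine le_iInf fun αA => le_iInf fun αP => le_iInf fun β => le_iInf fun β' => le_iInf fun hd => ?_
  obtain ⟨h1, h2, h3⟩ := dualFeasible_iff.mp hd
  have := hπ.integrated_le hp hp' hX hA (c := 1) h1 h2 (by simpa using h3)
  exact EReal.coe_le_coe_iff.mpr (by simpa using this)

/-! ### Moments of plans -/

variable (D)

/-- The moments of a plan that enter the primal problem: the two costs, the two families of marginal
masses, and the objective. -/
abbrev Moments : Type := ℝ × ℝ × (Fin D.nA → ℝ) × (Fin D.nP → ℝ) × ℝ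

/-- The moments of the unit mass at `z` in the component `(i, j, y)`. -/
noncomputable def pointMoments (θ : Fin (m₁ + m₂) → ℝ) (i : Fin D.nA) (j : Fin D.nP) (y : ℤˣ)
    (z : D.X × D.A) : D.Moments :=
  (D.dA i z.1 z.2, D.dP j z.1 y, Pi.single i 1, Pi.single j 1, loss θ z.1 z.2 y)

/-- The moments of a plan. -/
noncomputable def moments (θ : Fin (m₁ + m₂) → ℝ) (π : D.Plan) : D.Moments :=
  (∑ i, ∑ j, ∑ y, ∫ z, D.dA i z.1 z.2 ∂(π i j y), ∑ i, ∑ j, ∑ y, ∫ z, D.dP j z.1 y ∂(π i j y),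
    fun i => ∑ j, ∑ y, (π i j y).real Set.univ, fun j => ∑ i, ∑ y, (π i j y).real Set.univ,
    D.primalObjective θ π)

/-- The moments of all point masses. -/
def pointMomentSet (θ : Fin (m₁ + m₂) → ℝ) : Set D.Moments :=
  ⋃ (i) (j) (y), Set.range (D.pointMoments θ i j y)

/-- The moments of all finite plans. -/
def momentSet (θ : Fin (m₁ + m₂) → ℝ) : Set D.Moments :=
  {v | ∃ π : D.Plan, (∀ i j y, IsFiniteMeasure (π i j y)) ∧ D.moments θ π = v}

variable {D}

theorem isCompact_pointMomentSet (hp : 1 ≤ D.p) (hp' : 1 ≤ D.p') (hX : IsCompact D.X)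
    (hA : IsCompact D.A) (θ : Fin (m₁ + m₂) → ℝ) : IsCompact (D.pointMomentSet θ) := by
  have := isCompact_iff_compactSpace.mp hX
  have := isCompact_iff_compactSpace.mp hA
  refine isCompact_iUnion fun i => isCompact_iUnion fun j => isCompact_iUnion fun y => ?_
  exact isCompact_range ((D.continuous_dA hp hp' i).prodMk ((D.continuous_dP hp j y).prodMk
    (continuous_const.prodMk (continuous_const.prodMk (D.continuous_loss_coe θ y)))))

theorem sum_single_component (i : Fin D.nA) (j : Fin D.nP) (y : ℤˣ)
    (g : Fin D.nA → Fin D.nP → ℤˣ → ℝ) :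
    ∑ i', ∑ j', ∑ y', (if i' = i ∧ j' = j ∧ y' = y then g i' j' y' else 0) = g i j y := by
  rw [Fintype.sum_eq_single i fun i' h => by simp [h],
    Fintype.sum_eq_single j fun j' h => by simp [h],
    Fintype.sum_eq_single y fun y' h => if_neg fun h' => h h'.2.2]
  simp

theorem pointMomentSet_subset_momentSet (θ : Fin (m₁ + m₂) → ℝ) :
    D.pointMomentSet θ ⊆ D.momentSet θ := by
  intro v hv
  simp only [pointMomentSet, Set.mem_iUnion, Set.mem_range] at hv
  obtain ⟨i, j, y, z, rfl⟩ := hv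
  classical
  refine ⟨fun i' j' y' => if i' = i ∧ j' = j ∧ y' = y then Measure.dirac z else 0,
    fun i' j' y' => by dsimp only; split_ifs <;> infer_instance, ?_⟩
  have hI (i' j' y') (g : D.X × D.A → ℝ) :
      ∫ w, g w ∂(if i' = i ∧ j' = j ∧ y' = y then Measure.dirac z else 0)
        = if i' = i ∧ j' = j ∧ y' = y then g z else 0 := by
    split_ifs <;> simp
  have hM (i' j' y') :
      (if i' = i ∧ j' = j ∧ y' = y then Measure.dirac z else (0 : Measure (D.X × D.A))).real
        Set.univ = if i' = i ∧ j' = j ∧ y' = y then 1 else 0 := by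
    split_ifs <;> simp
  unfold moments pointMoments primalObjective
  simp only [hI, hM]
  simp only [Prod.mk.injEq]
  refine ⟨sum_single_component i j y fun i' _ _ => D.dA i' z.1 z.2,
    sum_single_component i j y fun _ j' y' => D.dP j' z.1 y', ?_, ?_,
    sum_single_component i j y fun _ _ y' => loss θ z.1 z.2 y'⟩
  · funext i'
    by_cases h : i' = i
    · subst h
      rw [Fintype.sum_eq_single j fun _ h => by simp [h],
        Fintype.sum_eq_single y fun _ h => if_neg fun h' => h h'.2.2]
      simp
    · simp [h]
  · funext j'
    by_cases h : j' = j
    · subst h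
      rw [Fintype.sum_eq_single i fun _ h => by simp [h],
        Fintype.sum_eq_single y fun _ h => if_neg fun h' => h h'.2.2]
      simp
    · simp [h]

theorem convex_momentSet (hp : 1 ≤ D.p) (hp' : 1 ≤ D.p') (hX : IsCompact D.X)
    (hA : IsCompact D.A) (θ : Fin (m₁ + m₂) → ℝ) : Convex ℝ (D.momentSet θ) := by
  rintro _ ⟨π, hπ, rfl⟩ _ ⟨ρ, hρ, rfl⟩ s t hs ht -
  lift s to NNReal using hs
  lift t to NNReal using ht
  have hI {g : D.X × D.A → ℝ} (hg : Continuous g) (i j y) :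
      ∫ z, g z ∂(s • π i j y + t • ρ i j y)
        = s * ∫ z, g z ∂(π i j y) + t * ∫ z, g z ∂(ρ i j y) := by
    have h1 := integrable_of_continuous hX hA (s • π i j y) hg
    have h2 := integrable_of_continuous hX hA (t • ρ i j y) hg
    rw [integral_add_measure h1 h2, integral_smul_nnreal_measure, integral_smul_nnreal_measure]
    rfl
  have hM (i j y) : (s • π i j y + t • ρ i j y).real Set.univ
      = s * (π i j y).real Set.univ + t * (ρ i j y).real Set.univ := by
    rw [measureReal_add_apply, measureReal_nnreal_smul_apply, measureReal_nnreal_smul_apply]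
  refine ⟨fun i j y => s • π i j y + t • ρ i j y, fun i j y => inferInstance, ?_⟩
  unfold moments primalObjective
  simp only [hI (D.continuous_dA hp hp' _), hI (D.continuous_dP hp _ _),
    hI (D.continuous_loss_coe θ _), hM, Finset.sum_add_distrib, ← Finset.mul_sum]
  rfl

theorem convexHull_pointMomentSet_subset (hp : 1 ≤ D.p) (hp' : 1 ≤ D.p') (hX : IsCompact D.X)
    (hA : IsCompact D.A) (θ : Fin (m₁ + m₂) → ℝ) :
    convexHull ℝ (D.pointMomentSet θ) ⊆ D.momentSet θ :=
  convexHull_min (pointMomentSet_subset_momentSet θ) (convex_momentSet hp hp' hX hA θ)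

/-- Moments record real masses, so this recovers the extended marginal constraints. Finiteness is
essential, since `Measure.real` sends an infinite mass to zero. -/
theorem PrimalFeasible.of_real {π : D.Plan} (hfin : ∀ i j y, IsFiniteMeasure (π i j y))
    (costA : ∑ i, ∑ j, ∑ y, ∫ z, D.dA i z.1 z.2 ∂(π i j y) ≤ D.rA)
    (costP : ∑ i, ∑ j, ∑ y, ∫ z, D.dP j z.1 y ∂(π i j y) ≤ D.rP)
    (marginalA : ∀ i, ∑ j, ∑ y, (π i j y).real Set.univ = 1 / (D.nA : ℝ))
    (marginalP : ∀ j, ∑ i, ∑ y, (π i j y).real Set.univ = 1 / (D.nP : ℝ)) :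
    D.PrimalFeasible π := by
  have inv_cast {n : ℕ} (hn : 0 < n) : ENNReal.ofReal (1 / (n : ℝ)) = 1 / (n : ℝ≥0∞) := by
    rw [ENNReal.ofReal_div_of_pos (by exact_mod_cast hn)]; simp
  refine ⟨costA, costP, fun i => ?_, fun j => ?_⟩
  · rw [← inv_cast i.pos, ← marginalA i,
      ENNReal.ofReal_sum_of_nonneg fun j _ => Finset.sum_nonneg fun y _ => measureReal_nonneg]
    refine Finset.sum_congr rfl fun _ _ => ?_
    rw [ENNReal.ofReal_sum_of_nonneg fun y _ => measureReal_nonneg]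
    exact Finset.sum_congr rfl fun _ _ => (ofReal_measureReal (measure_ne_top _ _)).symm
  · rw [← inv_cast j.pos, ← marginalP j,
      ENNReal.ofReal_sum_of_nonneg fun i _ => Finset.sum_nonneg fun y _ => measureReal_nonneg]
    refine Finset.sum_congr rfl fun _ _ => ?_
    rw [ENNReal.ofReal_sum_of_nonneg fun y _ => measureReal_nonneg]
    exact Finset.sum_congr rfl fun _ _ => (ofReal_measureReal (measure_ne_top _ _)).symm

/-! ### Separation and the dual multipliers -/

variable (D)

/-- The moments that a feasible plan with objective at least `c` may have. -/
def target (c : ℝ) : Set D.Moments :=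
  Set.Iic D.rA ×ˢ Set.Iic D.rP ×ˢ {fun _ => 1 / (D.nA : ℝ)} ×ˢ {fun _ => 1 / (D.nP : ℝ)} ×ˢ
    Set.Ici c

variable {D}

theorem disjoint_momentSet_target {θ : Fin (m₁ + m₂) → ℝ} {c : ℝ} (hc : D.primalValue θ < c) :
    Disjoint (D.momentSet θ) (D.target c) := by
  rw [Set.disjoint_left]
  rintro _ ⟨π, hπ, rfl⟩ ⟨hA, hP, hmA, hmP, hobj⟩
  have hf : D.PrimalFeasible π :=
    .of_real hπ hA hP (fun i => congrFun hmA i) (fun j => congrFun hmP j)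
  have h1 : (D.primalObjective θ π : EReal) ≤ D.primalValue θ :=
    le_iSup₂ (f := fun (π : D.Plan) (_ : D.PrimalFeasible π) => (D.primalObjective θ π : EReal))
      π hf
  exact absurd (EReal.coe_lt_coe_iff.mp (h1.trans_lt hc)) (not_lt.mpr hobj)

/-- A functional on the space of moments, in coordinates. -/
theorem moments_functional_apply (f : D.Moments →L[ℝ] ℝ) :
    ∃ (fA fP fl : ℝ) (w : Fin D.nA → ℝ) (w' : Fin D.nP → ℝ), ∀ a b e e' l,
      f (a, b, e, e', l) = fA * a + fP * b + ∑ i, e i * w i + ∑ j, e' j * w' j + fl * l := by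
  refine ⟨f (1, 0, 0, 0, 0), f (0, 1, 0, 0, 0), f (0, 0, 0, 0, 1),
    fun i => f (0, 0, Pi.single i 1, 0, 0), fun j => f (0, 0, 0, Pi.single j 1, 0),
    fun a b e e' l => ?_⟩
  have hv : ((a, b, e, e', l) : D.Moments) = a • (1, 0, 0, 0, 0) + b • (0, 1, 0, 0, 0)
      + ∑ i, e i • (0, 0, Pi.single i 1, 0, 0) + ∑ j, e' j • (0, 0, 0, Pi.single j 1, 0)
      + l • (0, 0, 0, 0, 1) := by
    simp only [Prod.ext_iff, Prod.fst_add, Prod.snd_add, Prod.fst_sum, Prod.snd_sum]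
    simp [funext_iff, Finset.sum_apply, Pi.single_apply]
  rw [hv]
  simp only [map_add, map_sum, map_smul, smul_eq_mul]
  ring

/-- A linear function bounded below on a ray cannot decrease along it; this reads off the multiplier
signs. -/
theorem nonneg_of_forall_lt_mul {k b : ℝ} (h : ∀ t : ℝ, 0 ≤ t → b < k * t) : 0 ≤ k := by
  by_contra! hk
  have h0 := h 0 le_rfl
  have := h (b / k) (div_nonneg_of_nonpos (by linarith) hk.le)
  rw [mul_div_cancel₀ _ hk.ne] at this
  exact lt_irrefl _ this

theorem exists_dualFeasible_lt (hp : 1 ≤ D.p) (hp' : 1 ≤ D.p') (hnA : 0 < D.nA)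
    (hX : IsCompact D.X) (hA : IsCompact D.A) (hfeas : ∃ π : D.Plan, D.PrimalFeasible π)
    {θ : Fin (m₁ + m₂) → ℝ} {c : ℝ} (hc : D.primalValue θ < c) :
    ∃ αA αP β β', D.DualFeasible θ αA αP β β' ∧ D.dualObjective αA αP β β' < c := by
  have hclosed : IsClosed (D.target c) :=
    isClosed_Iic.prod (isClosed_Iic.prod (isClosed_singleton.prod
      (isClosed_singleton.prod isClosed_Ici)))
  have hconv : Convex ℝ (D.target c) :=
    (convex_Iic _).prod ((convex_Iic _).prod ((convex_singleton _).prod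
      ((convex_singleton _).prod (convex_Ici _))))
  -- The hull replaces the whole `momentSet`, which is closed under nonnegative scaling and so not
  -- compact in general.
  obtain ⟨f, u, v, hfu, huv, hfv⟩ := geometric_hahn_banach_compact_closed (convex_convexHull ℝ _)
    (isCompact_pointMomentSet hp hp' hX hA θ).convexHull_of_finiteDimensional hconv hclosed
    ((disjoint_momentSet_target hc).mono_left (convexHull_pointMomentSet_subset hp hp' hX hA θ))
  obtain ⟨fA, fP, fl, w, w', hf⟩ := moments_functional_apply f
  have hpt (i j y) (z : D.X × D.A) :
      fl * loss θ z.1 z.2 y + fA * D.dA i z.1 z.2 + fP * D.dP j z.1 y + w i + w' j < u := by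
    have := hfu (D.pointMoments θ i j y z) (subset_convexHull ℝ _
      (Set.mem_iUnion_of_mem i (Set.mem_iUnion_of_mem j (Set.mem_iUnion_of_mem y ⟨z, rfl⟩))))
    simp only [pointMoments, hf] at this
    simp only [Pi.single_apply, ite_mul, one_mul, zero_mul, Finset.sum_ite_eq', Finset.mem_univ,
      if_true] at this
    linarith
  have htgt (a b l : ℝ) (ha : a ≤ D.rA) (hb : b ≤ D.rP) (hl : c ≤ l) :
      v < fA * a + fP * b + 1 / (D.nA : ℝ) * ∑ i, w i + 1 / (D.nP : ℝ) * ∑ j, w' j + fl * l := by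
    have := hfv (a, b, _, _, l) ⟨ha, hb, rfl, rfl, hl⟩
    simpa only [hf, Finset.mul_sum] using this
  have h0 := htgt _ _ _ le_rfl le_rfl le_rfl
  set K := fA * D.rA + fP * D.rP + 1 / (D.nA : ℝ) * ∑ i, w i + 1 / (D.nP : ℝ) * ∑ j, w' j + fl * c
    with hK
  have hfA : 0 ≤ -fA := nonneg_of_forall_lt_mul (b := v - K) fun t ht => by
    have := htgt (D.rA - t) D.rP c (by linarith) le_rfl le_rfl
    linarith
  have hfP : 0 ≤ -fP := nonneg_of_forall_lt_mul (b := v - K) fun t ht => by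
    have := htgt D.rA (D.rP - t) c le_rfl (by linarith) le_rfl
    linarith
  have hfl : 0 ≤ fl := nonneg_of_forall_lt_mul (b := v - K) fun t ht => by
    have := htgt D.rA D.rP (c + t) le_rfl le_rfl (by linarith)
    linarith
  have hnA' : (D.nA : ℝ) ≠ 0 := by exact_mod_cast hnA.ne'
  have hfl' : 0 < fl := by
    refine hfl.lt_of_ne fun h => ?_
    obtain ⟨π, hπ⟩ := hfeas
    -- With `fl = 0` the loss drops out, and integration gives `K ≤ u`, against `u < v < K`. The
    -- constant `u` goes into `β` because averaging over the `nA` indices returns `u`.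
    have := hπ.integrated_le hp hp' hX hA (θ := θ) (c := 0) (β := fun i => u - w i)
      (β' := fun j => -w' j) hfA hfP fun i j y z => by
        have := hpt i j y z
        rw [← h] at this
        linarith
    simp only [dualObjective, Finset.sum_sub_distrib, Finset.sum_neg_distrib, Finset.sum_const,
      Finset.card_univ, Fintype.card_fin, nsmul_eq_mul, mul_sub, ← mul_assoc,
      one_div_mul_cancel hnA'] at this
    rw [← h] at hK
    linarith
  refine ⟨-fA / fl, -fP / fl, fun i => (u - w i) / fl, fun j => -w' j / fl,
    dualFeasible_iff.mpr ⟨div_nonneg hfA hfl, div_nonneg hfP hfl, fun i j y z => ?_⟩, ?_⟩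
  · have := hpt i j y z
    rw [← add_div, le_div_iff₀ hfl']
    field_simp
    linarith
  · have hobj : D.dualObjective (-fA / fl) (-fP / fl) (fun i => (u - w i) / fl)
        (fun j => -w' j / fl) = (u - (K - fl * c)) / fl := by
      simp only [dualObjective, ← Finset.sum_div, Finset.sum_sub_distrib, Finset.sum_neg_distrib,
        Finset.sum_const, Finset.card_univ, Fintype.card_fin, nsmul_eq_mul, hK]
      field_simp
      ring
    -- What remains is `u - K + fl * c < fl * c`, that is, `u < K`.
    rw [hobj, div_lt_iff₀ hfl']
    linarith

end Problem

end DataJoin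

theorem theorem3 {m₁ m₂ : ℕ} (D : DataJoin.Problem m₁ m₂)
    (hp : 1 ≤ D.p) (hp' : 1 ≤ D.p') (hnA : 0 < D.nA) (hnP : 0 < D.nP)
    (hX : IsCompact D.X) (hA : IsCompact D.A)
    (hfeas : ∃ π : D.Plan, D.PrimalFeasible π) (θ : Fin (m₁ + m₂) → ℝ) :
    D.primalValue θ = D.dualValue θ := by
  refine le_antisymm (DataJoin.Problem.primalValue_le_dualValue hp hp' hX hA θ) ?_
  -- Testing against real `c` above the primal value avoids treating infinite values separately.
  refine EReal.le_of_forall_lt_iff_le.mp fun c hc => ?_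
  obtain ⟨αA, αP, β, β', hd, hlt⟩ :=
    DataJoin.Problem.exists_dualFeasible_lt hp hp' hnA hX hA hfeas hc
  refine le_trans ?_ (EReal.coe_le_coe_iff.mpr hlt.le)
  exact iInf_le_of_le αA (iInf_le_of_le αP (iInf_le_of_le β (iInf_le_of_le β'
    (iInf_le_of_le hd le_rfl))))
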